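/- **Theorem (realization).** Let $\Omega\subset\mathbb C^m$ be a bounded domain and let $K:\Omega\times\Omega\to\mathbb C$ be sesqui-analytic, i.e. $K(z,w)$ is holomorphic in $(z,\bar w)$. Assume that a continuous branch of $\log K$ exists on $\Omega\times\Omega$, fix one, and put $K^t:=\exp(t\log K)$ for $t\in\mathbb R$. Let $\alpha,\beta>0$ be such that $K^\alpha$ and $K^\beta$ are non-negative definite kernels on $\Omega$. Write $(\mathcal H,k)$ for the Hilbert space of functions with reproducing kernel $k$, where for a matrix valued kernel $k:\Omega\times\Omega\to\mathcal M_m(\mathbb C)$ the reproducing property is $\langle f,k(\cdot,w)\eta\rangle=\langle f(w),\eta\rangle_{\mathbb C^m}$, $\eta\in\mathbb C^m$. Realize the Hilbert space tensor product $\mathcal T:=(\mathcal H,K^\alpha)\otimes(\mathcal H,K^\beta)$ as a space of functions on $\Omega\times\Omega$ by $(f\otimes g)(z,\zeta)=f(z)g(\zeta)$. Let $\Delta=\{(z,z):z\in\Omega\}$, let $\partial_1,\dots,\partial_{2m}$ be the complex partial derivatives on $\Omega\times\Omega$, and define $$\mathbb K^{(\alpha,\beta)}(z,w)=K^{\alpha+\beta}(z,w)\big(\partial_i\bar\partial_j\log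 K(z,w)\big)_{i,j=1}^m,$$ $$\phi_i(w)=\beta\,\bar\partial_iK^\alpha(\cdot,w)\otimes K^\beta(\cdot,w)-\alpha\,K^\alpha(\cdot,w)\otimes\bar\partial_iK^\beta(\cdot,w),\qquad 1\le i\le m,\ w\in\Omega,$$ $$\mathcal A_0=\{f\in\mathcal T: f|_\Delta=0\},\qquad \mathcal A_1=\{f\in\mathcal A_0:(\partial_{m+1}f)|_\Delta=\dots=(\partial_{2m}f)|_\Delta=0\},$$ $$\mathcal R_1 f=\frac1{\sqrt{\alpha\beta(\alpha+\beta)}}\Big((\beta\partial_if-\alpha\partial_{m+i}f)|_\Delta\Big)_{i=1}^m,\qquad f\in\mathcal T.$$ Then: 1. every $f\in\mathcal T$ is holomorphic on $\Omega\times\Omega$, and every $\phi_i(w)$ belongs to $\mathcal T$; 2. the closed linear span $\mathcal N$ of $\{\phi_i(w):1\le i\le m,\ w\in\Omega\}$ equals $\mathcal A_0\ominus\mathcal A_1$; 3. $\mathbb K^{(\alpha,\beta)}$ is a non-negative definite kernel, and $(\mathcal H,\mathbb K^{(\alpha,\beta)})=\operatorname{ran}\mathcal R_1$ as sets of functions $\Omega\to\mathbb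 C^m$; 4. for all $f,g\in\mathcal T$, $\langle\mathcal R_1f,\mathcal R_1g\rangle_{(\mathcal H,\mathbb K^{(\alpha,\beta)})}=\langle P f,P g\rangle_{\mathcal T}$, where $P$ is the orthogonal projection of $\mathcal T$ onto $\mathcal A_0\ominus\mathcal A_1$. -/

import Mathlib

open scoped ComplexOrder ComplexConjugate TensorProduct InnerProductSpace

noncomputable section

namespace Realization

/-! ### The Hilbert space tensor product of two spaces of functions -/

section Tensor

variable (H₁ H₂ : Type*) {X₁ X₂ : Type*}
  [NormedAddCommGroup H₁] [InnerProductSpace ℂ H₁] [CompleteSpace H₁]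
  [NormedAddCommGroup H₂] [InnerProductSpace ℂ H₂] [CompleteSpace H₂]

/-- The Hilbert space tensor product: the completion of the algebraic tensor product with respect
to the inner product `⟪f ⊗ g, f' ⊗ g'⟫ = ⟪f, f'⟫ ⟪g, g'⟫`. -/
abbrev HilbertTensor : Type _ := UniformSpace.Completion (H₁ ⊗[ℂ] H₂)

variable [RKHS ℂ H₁ X₁ ℂ] [RKHS ℂ H₂ X₂ ℂ]

/-- The elementary tensor `k₁(·, x) ⊗ k₂(·, y)` of the two reproducing kernels. -/
def kerTensor (p : X₁ × X₂) : HilbertTensor H₁ H₂ :=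
  ((RKHS.kerFun H₁ p.1 1 ⊗ₜ[ℂ] RKHS.kerFun H₂ p.2 1 : H₁ ⊗[ℂ] H₂) : HilbertTensor H₁ H₂)

/-- Evaluation at the points of `X₁ × X₂`, as a continuous linear map. On elementary tensors it
is `(f ⊗ g) (x, y) = f x * g y`, see `tensorEval_tmul`. -/
def tensorEval : HilbertTensor H₁ H₂ →L[ℂ] (X₁ × X₂ → ℂ) :=
  ContinuousLinearMap.pi fun p => innerSL ℂ (kerTensor H₁ H₂ p)

theorem tensorEval_tmul (f : H₁) (g : H₂) (p : X₁ × X₂) :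
    tensorEval H₁ H₂ ((f ⊗ₜ[ℂ] g : H₁ ⊗[ℂ] H₂) : HilbertTensor H₁ H₂) p = f p.1 * g p.2 := by
  simp [tensorEval, kerTensor, UniformSpace.Completion.inner_coe, TensorProduct.inner_tmul]

theorem tensorEval_injective :
    Function.Injective (tensorEval H₁ H₂ : HilbertTensor H₁ H₂ → X₁ × X₂ → ℂ) := by
  refine (injective_iff_map_eq_zero _).mpr fun F hF => ?_
  -- the sections `f ↦ f ⊗ g` and `g ↦ f ⊗ g`
  let A : H₂ → H₁ →L[ℂ] HilbertTensor H₁ H₂ := fun g =>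
    UniformSpace.Completion.toComplL ∘L (TensorProduct.mkL ℂ H₁ H₂).flip g
  let B : H₁ → H₂ →L[ℂ] HilbertTensor H₁ H₂ := fun f =>
    UniformSpace.Completion.toComplL ∘L TensorProduct.mkL ℂ H₁ H₂ f
  have hA : ∀ y : X₂, (A (RKHS.kerFun H₂ y 1)).adjoint F = 0 := by
    intro y
    refine RKHS.ext fun x => ?_
    have h0 : ⟪A (RKHS.kerFun H₂ y 1) (RKHS.kerFun H₁ x 1), F⟫_ℂ = 0 := congrFun hF (x, y)
    rw [← ContinuousLinearMap.adjoint_inner_right, RKHS.kerFun_inner] at h0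
    simpa using h0
  have key : ∀ (f : H₁) (g : H₂),
      ⟪((f ⊗ₜ[ℂ] g : H₁ ⊗[ℂ] H₂) : HilbertTensor H₁ H₂), F⟫_ℂ = 0 := by
    intro f g
    have hB : (B f).adjoint F = 0 := by
      refine RKHS.ext fun y => ?_
      have h0 : ⟪A (RKHS.kerFun H₂ y 1) f, F⟫_ℂ = 0 := by
        rw [← ContinuousLinearMap.adjoint_inner_right, hA y, inner_zero_right]
      have h1 : ⟪B f (RKHS.kerFun H₂ y 1), F⟫_ℂ = 0 := h0
      rw [← ContinuousLinearMap.adjoint_inner_right, RKHS.kerFun_inner] at h1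
      simpa using h1
    have h2 : ⟪B f g, F⟫_ℂ = 0 := by
      rw [← ContinuousLinearMap.adjoint_inner_right, hB, inner_zero_right]
    exact h2
  refine UniformSpace.Completion.denseRange_coe.eq_zero_of_inner_right ℂ fun t => ?_
  induction t using TensorProduct.induction_on with
  | zero =>
    have h : (((0 : H₁ ⊗[ℂ] H₂)) : HilbertTensor H₁ H₂) = 0 := UniformSpace.Completion.coe_zero
    rw [h, inner_zero_left]
  | tmul f g => exact key f g
  | add a b ha hb => rw [UniformSpace.Completion.coe_add, inner_add_left, ha, hb, add_zero]

/-- The tensor product of two Hilbert spaces of functions, realized as a Hilbert space of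
functions on the product. -/
instance instRKHSTensor : RKHS ℂ (HilbertTensor H₁ H₂) (X₁ × X₂) ℂ where
  coeCLM := tensorEval H₁ H₂
  coeCLM_injective := tensorEval_injective H₁ H₂

/-- The realization is the expected one on elementary tensors. -/
theorem tmul_apply (f : H₁) (g : H₂) (x : X₁) (y : X₂) :
    ((f ⊗ₜ[ℂ] g : H₁ ⊗[ℂ] H₂) : HilbertTensor H₁ H₂) (x, y) = f x * g y :=
  tensorEval_tmul H₁ H₂ f g (x, y)

end Tensor

/-! ### Complex derivatives and kernels -/

section Kernels

variable {m : ℕ}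

/-- The complex partial derivative `∂f/∂z_i`. -/
def pderiv (i : Fin m) (f : EuclideanSpace ℂ (Fin m) → ℂ) (z : EuclideanSpace ℂ (Fin m)) : ℂ :=
  lineDeriv ℂ f z (EuclideanSpace.single i 1)

/-- The partial derivative `∂f/∂(conj w_i)` of an anti-holomorphic function `f`, which is the
conjugate of the complex partial derivative of the holomorphic function `conj f`. -/
def pderivBar (i : Fin m) (f : EuclideanSpace ℂ (Fin m) → ℂ)
    (w : EuclideanSpace ℂ (Fin m)) : ℂ :=
  conj (pderiv i (fun v => conj (f v)) w)

/-- Coordinatewise complex conjugation. -/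
def conjVec (w : EuclideanSpace ℂ (Fin m)) : EuclideanSpace ℂ (Fin m) :=
  WithLp.toLp 2 fun i => conj (w i)

/-- `K` is sesqui-analytic on `Ω × Ω`: holomorphic in the first `m` variables and
anti-holomorphic in the last `m`, that is, a holomorphic function of `(z, conj w)`. -/
def SesquiAnalyticOn (K : EuclideanSpace ℂ (Fin m) → EuclideanSpace ℂ (Fin m) → ℂ)
    (Ω : Set (EuclideanSpace ℂ (Fin m))) : Prop :=
  DifferentiableOn ℂ
    (fun p : EuclideanSpace ℂ (Fin m) × EuclideanSpace ℂ (Fin m) => K p.1 (conjVec p.2))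
    {p | p.1 ∈ Ω ∧ conjVec p.2 ∈ Ω}

/-- `L` is a continuous branch of `log K` on `Ω × Ω`. -/
def IsLogBranchOn (L K : EuclideanSpace ℂ (Fin m) → EuclideanSpace ℂ (Fin m) → ℂ)
    (Ω : Set (EuclideanSpace ℂ (Fin m))) : Prop :=
  ContinuousOn (Function.uncurry L) (Ω ×ˢ Ω) ∧ ∀ z ∈ Ω, ∀ w ∈ Ω, Complex.exp (L z w) = K z w

/-- The real power `K ^ t = exp (t log K)`, where `L` is the branch of `log K`. -/
def kpow (L : EuclideanSpace ℂ (Fin m) → EuclideanSpace ℂ (Fin m) → ℂ) (t : ℝ)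
    (z w : EuclideanSpace ℂ (Fin m)) : ℂ :=
  Complex.exp ((t : ℂ) * L z w)

/-- A scalar function on `Ω × Ω` as a kernel with values in the operators on `ℂ`. -/
def scalarKernel (Ω : Set (EuclideanSpace ℂ (Fin m)))
    (k : EuclideanSpace ℂ (Fin m) → EuclideanSpace ℂ (Fin m) → ℂ) : Matrix Ω Ω (ℂ →L[ℂ] ℂ) :=
  Matrix.of fun z w => k z w • ContinuousLinearMap.id ℂ ℂ

/-- The matrix valued kernel `K ^ (α + β) (∂_i ∂bar_j log K)_{i, j}` on `Ω × Ω`, where `L` is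
the branch of `log K`. -/
def bigKernel (Ω : Set (EuclideanSpace ℂ (Fin m)))
    (L : EuclideanSpace ℂ (Fin m) → EuclideanSpace ℂ (Fin m) → ℂ) (α β : ℝ) :
    Matrix Ω Ω (EuclideanSpace ℂ (Fin m) →L[ℂ] EuclideanSpace ℂ (Fin m)) :=
  Matrix.of fun z w => Matrix.toEuclideanCLM (𝕜 := ℂ) (n := Fin m) <|
    Matrix.of fun i j =>
      kpow L (α + β) z w * pderiv i (fun z' => pderivBar j (fun w' => L z' w') w) z

/-- The function `β ∂bar_i K^α(·, w) ⊗ K^β(·, w) - α K^α(·, w) ⊗ ∂bar_i K^β(·, w)` on `Ω × Ω`. -/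
def phi (Ω : Set (EuclideanSpace ℂ (Fin m)))
    (L : EuclideanSpace ℂ (Fin m) → EuclideanSpace ℂ (Fin m) → ℂ) (α β : ℝ)
    (i : Fin m) (w : Ω) : Ω × Ω → ℂ := fun p =>
  β * (pderivBar i (fun v => kpow L α p.1 v) w * kpow L β p.2 w)
    - α * (kpow L α p.1 w * pderivBar i (fun v => kpow L β p.2 v) w)

/-- Extension of a function on `S` by zero. It serves only to differentiate functions given on
an open set, at points of this set. -/
def zeroExt {E : Type*} {S : Set E} (f : S → ℂ) : E → ℂ :=
  Function.extend Subtype.val f 0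

/-- Holomorphy of a function on `Ω × Ω`. -/
def HolomorphicOnProd {Ω : Set (EuclideanSpace ℂ (Fin m))} (f : Ω × Ω → ℂ) : Prop :=
  DifferentiableOn ℂ
    (Function.extend (Prod.map Subtype.val Subtype.val) f 0 :
      EuclideanSpace ℂ (Fin m) × EuclideanSpace ℂ (Fin m) → ℂ) (Ω ×ˢ Ω)

/-- The map `f ↦ (αβ(α+β))^(-1/2) ((β ∂_i f - α ∂_{m+i} f)|_Δ)_i`. -/
def R₁ {Ω : Set (EuclideanSpace ℂ (Fin m))} (α β : ℝ) (f : Ω × Ω → ℂ) :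
    Ω → EuclideanSpace ℂ (Fin m) := fun w =>
  WithLp.toLp 2 fun i => ((1 / Real.sqrt (α * β * (α + β)) : ℝ) : ℂ) *
    (β * pderiv i (zeroExt fun z : Ω => f (z, w)) w
      - α * pderiv i (zeroExt fun ζ : Ω => f (w, ζ)) w)

end Kernels

/-! ### The subspaces of the tensor product -/

section Subspaces

variable {m : ℕ} {Ω : Set (EuclideanSpace ℂ (Fin m))}
  (T : Type*) [NormedAddCommGroup T] [InnerProductSpace ℂ T]
  [RKHS ℂ T (Ω × Ω) ℂ]

/-- The functions that vanish on the diagonal. -/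
def A₀ : Submodule ℂ T where
  carrier := {f | ∀ w : Ω, f (w, w) = 0}
  zero_mem' := by intro w; simp
  add_mem' := by
    intro f g hf hg w
    simp [hf w, hg w]
  smul_mem' := by
    intro c f hf w
    simp [hf w]

/-- The functions `f` that vanish on the diagonal together with the derivatives
`∂_{m+1} f, …, ∂_{2m} f`. -/
def A₁ : Submodule ℂ T where
  carrier := {f | ∀ w : Ω, f (w, w) = 0 ∧ ∀ i : Fin m,
    HasLineDerivAt ℂ (zeroExt fun ζ : Ω => f (w, ζ)) 0 (w : EuclideanSpace ℂ (Fin m))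
      (EuclideanSpace.single i 1)}
  zero_mem' := by
    intro w
    refine ⟨by simp, fun i => ?_⟩
    have h : (zeroExt fun ζ : Ω => (0 : T) (w, ζ)) = fun _ => 0 := by
      funext x
      by_cases hx : x ∈ Ω
      · have := Subtype.val_injective.extend_apply
          (fun ζ : Ω => (0 : T) (w, ζ)) 0 ⟨x, hx⟩
        simpa [zeroExt] using this
      · simp [zeroExt, hx]
    rw [h]
    exact hasDerivAt_const _ _
  add_mem' := by
    intro f g hf hg w
    refine ⟨by simp [(hf w).1, (hg w).1], fun i => ?_⟩
    have h : (zeroExt fun ζ : Ω => (f + g) (w, ζ)) =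
        (zeroExt fun ζ : Ω => f (w, ζ)) + zeroExt fun ζ : Ω => g (w, ζ) := by
      funext x
      by_cases hx : x ∈ Ω
      · have h1 := Subtype.val_injective.extend_apply (fun ζ : Ω => (f + g) (w, ζ)) 0 ⟨x, hx⟩
        have h2 := Subtype.val_injective.extend_apply (fun ζ : Ω => f (w, ζ)) 0 ⟨x, hx⟩
        have h3 := Subtype.val_injective.extend_apply (fun ζ : Ω => g (w, ζ)) 0 ⟨x, hx⟩
        simp only [zeroExt, Pi.add_apply]
        simp only at h1 h2 h3
        rw [h1, h2, h3]
        simp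
      · simp [zeroExt, hx]
    rw [h]
    have := HasDerivAt.add ((hf w).2 i) ((hg w).2 i)
    rw [add_zero] at this
    exact this
  smul_mem' := by
    intro c f hf w
    refine ⟨by simp [(hf w).1], fun i => ?_⟩
    have h : (zeroExt fun ζ : Ω => (c • f) (w, ζ)) = c • zeroExt fun ζ : Ω => f (w, ζ) := by
      funext x
      by_cases hx : x ∈ Ω
      · have h1 := Subtype.val_injective.extend_apply (fun ζ : Ω => (c • f) (w, ζ)) 0 ⟨x, hx⟩
        have h2 := Subtype.val_injective.extend_apply (fun ζ : Ω => f (w, ζ)) 0 ⟨x, hx⟩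
        simp only [zeroExt, Pi.smul_apply]
        simp only at h1 h2
        rw [h1, h2]
        simp
      · simp [zeroExt, hx]
    rw [h]
    have := HasDerivAt.const_smul c ((hf w).2 i)
    rw [smul_zero] at this
    exact this

/-- The orthogonal complement `A₀ ⊖ A₁` of `A₁` in `A₀`. -/
def S₁ : Submodule ℂ T := A₀ T ⊓ (A₁ T)ᗮ

theorem isClosed_S₁ : IsClosed (S₁ T : Set T) := by
  have h0 : IsClosed (A₀ T : Set T) := by
    have : (A₀ T : Set T) = ⋂ w : Ω, {f : T | f (w, w) = 0} := by
      ext f; simp [A₀]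
    rw [this]
    exact isClosed_iInter fun w => isClosed_eq (RKHS.continuous_eval (w, w)) continuous_const
  exact h0.inter (Submodule.isClosed_orthogonal _)

instance instCompleteS₁ [CompleteSpace T] : CompleteSpace (S₁ T) :=
  (isClosed_S₁ T).completeSpace_coe

/-- The closed linear span of the vectors `φ_i(w)`. -/
def N (L : EuclideanSpace ℂ (Fin m) → EuclideanSpace ℂ (Fin m) → ℂ) (α β : ℝ) :
    Submodule ℂ T :=
  (Submodule.span ℂ {f : T | ∃ (i : Fin m) (w : Ω), ⇑f = phi Ω L α β i w}).topologicalClosure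

end Subspaces

/-- The Hilbert space `(H, K^α) ⊗ (H, K^β)`, a space of functions on `Ω × Ω`. -/
abbrev TensorSpace {m : ℕ} (Ω : Set (EuclideanSpace ℂ (Fin m)))
    (L : EuclideanSpace ℂ (Fin m) → EuclideanSpace ℂ (Fin m) → ℂ) (α β : ℝ)
    [Fact (scalarKernel Ω (kpow L α)).PosSemidef]
    [Fact (scalarKernel Ω (kpow L β)).PosSemidef] : Type :=
  HilbertTensor (RKHS.OfKernel (scalarKernel Ω (kpow L α)))
    (RKHS.OfKernel (scalarKernel Ω (kpow L β)))

end Realization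

end

/-! The kernel functions span a dense subspace of `𝒯` and are holomorphic, and evaluations are
locally bounded in norm, so all of `𝒯` is holomorphic and derivatives at a point are bounded
functionals. The Riesz vector of `f ↦ (β ∂_i f - α ∂_{m+i} f)(w, w)` turns out to be `φ_i(w)`
(`coe_phiVec`).

Two facts about these vectors carry the theorem. Since `∂bar_i K^t = t K^t ∂bar_i log K`, the
weights `β` and `α` make `φ_i(w)` equal to `αβ K^α ⊗ K^β` times a difference of the values of
`∂bar_i log K(·, w)` in the two slots; hence it vanishes on the diagonal (`phi_apply`). A function
vanishing on the diagonal has `∂_i f = -∂_{m+i} f` there, so its pairing with `φ_i(w)` is `-(α+β)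
∂_{m+i} f(w, w)`. Thus inside `A₀` the orthogonal complement of the `φ_i(w)` is `A₁`, and their
closed span is `A₀ ⊖ A₁`.

The Gram matrix of the `φ_i(w)` is `αβ(α+β)` times the matrix kernel (`phiVec_inner_phiVec`). After
normalization they form a feature map whose adjoints are `f ↦ R₁ f (w)` (`bigKernel_eq`,
`adjoint_feature_apply`). The range and inner product statements then hold for any feature map
(`range_and_inner_of_kernel_eq`): the kernel space embeds isometrically onto `A₀ ⊖ A₁`, with adjoint
`R₁`. -/

noncomputable section

namespace Realization

/-! ### Holomorphic functions: limits, derivative functionals, logarithms. -/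

section Holomorphy

open Filter Topology Metric

variable {E H : Type*} [NormedAddCommGroup E] [NormedSpace ℂ E]
  [NormedAddCommGroup H] [NormedSpace ℂ H]

/-- A Cauchy estimate for the Fréchet derivative of a holomorphic function. -/
theorem norm_fderiv_le_of_norm_le {f : E → ℂ} {c : E} {r M : ℝ} (hr : 0 < r)
    (hf : DifferentiableOn ℂ f (ball c r)) (hM : ∀ x ∈ ball c r, ‖f x‖ ≤ M) :
    ‖fderiv ℂ f c‖ ≤ 2 * M / r := by
  refine Complex.norm_fderiv_le_div_of_mapsTo_ball hf (fun x hx => ?_) hr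
  rw [mem_closedBall, dist_eq_norm]
  linarith [norm_sub_le (f x) (f c), hM x hx, hM c (mem_ball_self hr)]

/-- Functions in the closure of the holomorphic functions are holomorphic, if the evaluations
are locally bounded. -/
theorem differentiableOn_of_mem_closure {U : Set E} (hU : IsOpen U) (ev : E → H →L[ℂ] ℂ)
    (hev : ∀ p ∈ U, ∃ C : ℝ, ∀ᶠ x in 𝓝 p, ‖ev x‖ ≤ C) {f : H}
    (hf : f ∈ closure {g : H | DifferentiableOn ℂ (fun x => ev x g) U}) :
    DifferentiableOn ℂ (fun x => ev x f) U := by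
  obtain ⟨u, hu, hlim⟩ := mem_closure_iff_seq_limit.mp hf
  intro p hp
  obtain ⟨C, hC⟩ := hev p hp
  obtain ⟨r, hr, hball⟩ := Metric.eventually_nhds_iff_ball.mp (hC.and (hU.mem_nhds hp))
  have hC0 : 0 ≤ C := (norm_nonneg _).trans (hball p (mem_ball_self hr)).1
  have hsub : ∀ x ∈ ball p (r / 2), ball x (r / 2) ⊆ ball p r := by
    intro x hx y hy
    rw [mem_ball] at *
    linarith [dist_triangle y x p]
  have hdiff : ∀ n, ∀ x ∈ ball p r, DifferentiableAt ℂ (fun x => ev x (u n)) x := fun n x hx =>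
    (hu n x (hball x hx).2).differentiableAt (hU.mem_nhds (hball x hx).2)
  -- The difference is bounded by `C * ‖u n - u k‖` on the ball of radius `r / 2` about `x`; the
  -- Cauchy estimate then gives `2 C / (r / 2) = 4 C / r`.
  have hest : ∀ n k, ∀ x ∈ ball p (r / 2),
      ‖fderiv ℂ (fun x => ev x (u n)) x - fderiv ℂ (fun x => ev x (u k)) x‖ ≤
        4 * C / r * ‖u n - u k‖ := by
    intro n k x hx
    have hxr : x ∈ ball p r := hsub x hx (mem_ball_self (by positivity))
    rw [← fderiv_fun_sub (hdiff n x hxr) (hdiff k x hxr)]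
    refine (norm_fderiv_le_of_norm_le (M := C * ‖u n - u k‖) (half_pos hr)
      (fun y hy => ((hdiff n y (hsub x hx hy)).sub
        (hdiff k y (hsub x hx hy))).differentiableWithinAt) fun y hy => ?_).trans_eq ?_
    · rw [Pi.sub_apply, ← map_sub]
      exact (ev y).le_of_opNorm_le (hball y (hsub x hx hy)).1 _
    · field_simp; ring
  have hcauchy : UniformCauchySeqOn (fun n x => fderiv ℂ (fun x => ev x (u n)) x) atTop
      (ball p (r / 2)) := by
    rw [Metric.uniformCauchySeqOn_iff]
    intro ε hε
    -- The added `1` allows division even when `C = 0`.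
    have hpos : 0 < 4 * C / r + 1 := by positivity
    obtain ⟨n₀, hn₀⟩ := Metric.cauchySeq_iff.mp hlim.cauchySeq (ε / (4 * C / r + 1))
      (by positivity)
    refine ⟨n₀, fun n hn k hk x hx => ?_⟩
    have h1 := hn₀ n hn k hk
    rw [dist_eq_norm] at h1 ⊢
    rw [lt_div_iff₀ hpos] at h1
    refine (hest n k x hx).trans_lt (lt_of_le_of_lt ?_ h1)
    nlinarith [norm_nonneg (u n - u k)]
  have hex : ∀ x ∈ ball p (r / 2), ∃ g', Tendsto
      (fun n => fderiv ℂ (fun x => ev x (u n)) x) atTop (𝓝 g') := fun x hx =>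
    cauchySeq_tendsto_of_complete (hcauchy.cauchySeq hx)
  choose! g' hg' using hex
  have := hasFDerivAt_of_tendstoUniformlyOn isOpen_ball
    (hcauchy.tendstoUniformlyOn_of_tendsto hg')
    (fun n x hx => (hdiff n x (hsub x hx (mem_ball_self (by positivity)))).hasFDerivAt)
    (fun x _ => ((ev x).continuous.tendsto f).comp hlim) (mem_ball_self (half_pos hr))
  exact this.differentiableAt.differentiableWithinAt

/-- If every function of a Banach space of functions with continuous evaluations is
differentiable at `p`, then the directional derivatives at `p` are continuous functionals. -/
theorem exists_clm_eq_fderiv [CompleteSpace H] (ev : E → H →L[ℂ] ℂ) {p : E}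
    (hev : ∀ f, DifferentiableAt ℂ (fun x => ev x f) p) (v : E) :
    ∃ D : H →L[ℂ] ℂ, ∀ f, D f = fderiv ℂ (fun x => ev x f) p v := by
  -- The difference quotients are bounded functionals that converge pointwise; by Banach–Steinhaus
  -- the limit is bounded.
  have h : Tendsto (fun (t : ℂ) (f : H) => (t⁻¹ • (ev (p + t • v) - ev p)) f) (𝓝[≠] 0)
      (𝓝 fun f => fderiv ℂ (fun x => ev x f) p v) := by
    refine tendsto_pi_nhds.mpr fun f => ?_
    have := ((hev f).hasFDerivAt.hasLineDerivAt v).tendsto_slope_zero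
    simpa using this
  exact ⟨continuousLinearMapOfTendsto _ h, fun f => rfl⟩

/-- A continuous function whose exponential (up to scaling) is holomorphic is holomorphic. -/
theorem differentiableAt_of_exp {g : E → ℂ} {p : E} {c : ℂ} (hc : c ≠ 0)
    (hg : ContinuousAt g p) (he : DifferentiableAt ℂ (fun x => Complex.exp (c * g x)) p) :
    DifferentiableAt ℂ g p := by
  -- The quotient is `1` at `p`, so the principal logarithm is holomorphic there. It recovers `c *
  -- (g x - g p)` as soon as the imaginary part lies in `(-π, π)`, which continuity of `g` ensures
  -- near `p`.
  have h1 : DifferentiableAt ℂ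
      (fun x => c⁻¹ * Complex.log (Complex.exp (c * g x) / Complex.exp (c * g p)) + g p) p := by
    have hquot : DifferentiableAt ℂ (fun x => Complex.exp (c * g x) / Complex.exp (c * g p)) p := by
      simpa only [div_eq_mul_inv] using he.mul_const _
    refine ((hquot.clog ?_).const_mul _).add_const _
    rw [div_self (Complex.exp_ne_zero _)]
    exact Complex.one_mem_slitPlane
  refine h1.congr_of_eventuallyEq ?_
  have h2 : Tendsto (fun x => (c * g x - c * g p).im) (𝓝 p) (𝓝 0) := by
    have : ContinuousAt (fun x => (c * g x - c * g p).im) p := by fun_prop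
    simpa [ContinuousAt] using this
  filter_upwards [h2.eventually (Ioo_mem_nhds (neg_lt_zero.mpr Real.pi_pos) Real.pi_pos)] with x hx
  rw [← Complex.exp_sub, Complex.log_exp hx.1 hx.2.le]
  field_simp
  ring

end Holomorphy

/-! ### Reproducing kernel spaces and feature maps. -/

section Transport

variable {X V T : Type*} [NormedAddCommGroup V] [InnerProductSpace ℂ V] [CompleteSpace V]
  [NormedAddCommGroup T] [InnerProductSpace ℂ T] [CompleteSpace T]

open ContinuousLinearMap

/-- The kernel with feature map `E` is non-negative definite. -/
theorem posSemidef_adjoint_comp (E : X → V →L[ℂ] T) :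
    (Matrix.of fun x y => (E x).adjoint ∘L E y : Matrix X X (V →L[ℂ] V)).PosSemidef := by
  set K : Matrix X X (V →L[ℂ] V) := Matrix.of fun x y => (E x).adjoint ∘L E y with hK
  have htfae := (RKHS.posSemidef_tfae (K := K)).out 0 2
  refine htfae.mpr ⟨?_, fun vv => ?_⟩
  · refine Matrix.IsHermitian.ext fun x y => ?_
    simp [hK, star_eq_adjoint, adjoint_comp]
  · have : (vv.sum fun x w => vv.sum fun x' w' => ⟪(E x').adjoint (E x w), w'⟫_ℂ) =
        ⟪vv.sum fun x w => E x w, vv.sum fun x w => E x w⟫_ℂ := by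
      simp only [Finsupp.sum_inner, Finsupp.inner_sum, adjoint_inner_left]
      exact Finsupp.sum_comm _ _ _
    simp only [hK, Matrix.of_apply, coe_comp, Function.comp_apply]
    rw [this]
    exact inner_self_nonneg

/-- A reproducing kernel Hilbert space embeds isometrically into the target of any
feature map of its kernel. -/
theorem exists_isometry_of_kernel_eq {H : Type*} [NormedAddCommGroup H] [InnerProductSpace ℂ H]
    [CompleteSpace H] [RKHS ℂ H X V] (E : X → V →L[ℂ] T)
    (hE : ∀ x y, RKHS.kernel H x y = (E x).adjoint ∘L E y) :
    ∃ U : H →ₗᵢ[ℂ] T, ∀ x v, U (RKHS.kerFun H x v) = E x v := by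
  -- Formal combinations of kernel functions are sent to `H` by `a` and to `T` by `b`. Equal Gram
  -- matrices give `‖b s‖ = ‖a s‖`, so `b` factors isometrically through the dense range of `a`.
  let a : (X × V →₀ ℂ) →ₗ[ℂ] H := Finsupp.linearCombination ℂ fun p => RKHS.kerFun H p.1 p.2
  let b : (X × V →₀ ℂ) →ₗ[ℂ] T := Finsupp.linearCombination ℂ fun p => E p.1 p.2
  have hin : ∀ s, ⟪a s, a s⟫_ℂ = ⟪b s, b s⟫_ℂ := by
    intro s
    simp only [a, b, Finsupp.linearCombination_apply, Finsupp.sum_inner, Finsupp.inner_sum,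
      inner_smul_left, inner_smul_right]
    have h : ∀ p q : X × V, ⟪RKHS.kerFun H p.1 p.2, RKHS.kerFun H q.1 q.2⟫_ℂ =
        ⟪E p.1 p.2, E q.1 q.2⟫_ℂ := fun p q => by
      rw [RKHS.kerFun_inner, RKHS.kerFun_apply, hE, comp_apply, adjoint_inner_right]
    simp only [h]
  have hnorm : ∀ s, ‖b s‖ = ‖a s‖ := by
    intro s
    rw [@norm_eq_sqrt_re_inner ℂ, @norm_eq_sqrt_re_inner ℂ, hin]
  have hdense : DenseRange a := by
    have h1 : (LinearMap.range a : Set H) = Submodule.span ℂ {RKHS.kerFun H x v | (x) (v)} := by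
      rw [Finsupp.range_linearCombination]
      congr 2
      ext; simp
    have h2 := RKHS.kerFun_dense H
    rw [DenseRange, ← LinearMap.coe_range, h1]
    exact Submodule.dense_iff_topologicalClosure_eq_top.mpr h2
  let U := b.extendOfNorm a
  have hU : ∀ s, U (a s) = b s := fun s =>
    LinearMap.extendOfNorm_eq hdense ⟨1, fun s => by rw [hnorm, one_mul]⟩ s
  refine ⟨⟨U.toLinearMap, fun f => ?_⟩, fun x v => ?_⟩
  · refine hdense.induction_on (p := fun f => ‖U f‖ = ‖f‖) f
      (isClosed_eq (by fun_prop) continuous_norm) fun s => ?_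
    rw [hU, hnorm]
  · have := hU (Finsupp.single (x, v) 1)
    simpa [a, b] using this

/-- The reproducing kernel Hilbert space of the kernel with feature map `E` consists of the
functions `x ↦ (E x)† f`, and its inner product is transported by the orthogonal projection
onto the closed span of the ranges of `E`. -/
theorem range_and_inner_of_kernel_eq {H : Type*} [NormedAddCommGroup H] [InnerProductSpace ℂ H]
    [CompleteSpace H] [RKHS ℂ H X V] (E : X → V →L[ℂ] T)
    (hE : ∀ x y, RKHS.kernel H x y = (E x).adjoint ∘L E y)
    (S : Submodule ℂ T) [S.HasOrthogonalProjection] (hS : IsClosed (S : Set T))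
    (hmem : ∀ x v, E x v ∈ S) (hzero : ∀ f ∈ S, (∀ x, (E x).adjoint f = 0) → f = 0) :
    Set.range (fun F : H => ⇑F) = Set.range (fun f : T => fun x => (E x).adjoint f) ∧
    ∀ (f g : T) (F G : H), (⇑F = fun x => (E x).adjoint f) → (⇑G = fun x => (E x).adjoint g) →
      ⟪F, G⟫_ℂ = ⟪S.starProjection f, S.starProjection g⟫_ℂ := by
  obtain ⟨U, hU⟩ := exists_isometry_of_kernel_eq (H := H) E hE
  let W := U.toContinuousLinearMap
  have hW : ∀ F, W F = U F := fun _ => rfl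
  have hadj : ∀ f : T, ⇑(W.adjoint f) = fun x => (E x).adjoint f := by
    intro f
    funext x
    refine ext_inner_left ℂ fun v => ?_
    rw [← RKHS.kerFun_inner, adjoint_inner_right, adjoint_inner_right, hW, hU]
  have hWW : ∀ F, W.adjoint (W F) = F := by
    intro F
    refine ext_inner_left ℂ fun G => ?_
    rw [adjoint_inner_right, hW, hW, U.inner_map_map]
  have hWS : ∀ F, W F ∈ S := by
    intro F
    have hF : F ∈ (Submodule.span ℂ {RKHS.kerFun H x v | (x) (v)}).topologicalClosure := by
      rw [RKHS.kerFun_dense]; trivial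
    refine (Submodule.topologicalClosure_minimal (t := S.comap W.toLinearMap) _
      (Submodule.span_le.mpr ?_) (hS.preimage W.continuous)) hF
    rintro _ ⟨x, v, rfl⟩
    change W _ ∈ S
    rw [hW, hU]
    exact hmem x v
  -- The defect `s - W W† s` lies in `S`, and `W† W = 1` shows that every `(E x)†` kills it. So `W`
  -- maps onto `S` and `W W†` is the projection onto `S`.
  have hfix : ∀ s ∈ S, W (W.adjoint s) = s := by
    intro s hs
    refine (sub_eq_zero.mp (hzero _ (S.sub_mem hs (hWS _)) fun x => ?_)).symm
    have h1 := congrFun (hadj s) x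
    have h2 := congrFun (hadj (W (W.adjoint s))) x
    rw [hWW] at h2
    rw [map_sub, ← h1, ← h2, sub_self]
  have hproj : ∀ f, S.starProjection f = W (W.adjoint f) := by
    intro f
    refine Submodule.eq_starProjection_of_mem_of_inner_eq_zero (hWS _) fun s hs => ?_
    rw [← hfix s hs, ← adjoint_inner_left, map_sub, hWW, sub_self, inner_zero_left]
  refine ⟨Set.ext fun φ => ⟨?_, ?_⟩, fun f g F G hF hG => ?_⟩
  · rintro ⟨F, rfl⟩
    exact ⟨W F, by simp only [← hadj, hWW]⟩
  · rintro ⟨f, rfl⟩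
    exact ⟨W.adjoint f, hadj f⟩
  · rw [← hadj] at hF hG
    rw [DFunLike.coe_injective hF, DFunLike.coe_injective hG, hproj, hproj, hW, hW,
      U.inner_map_map]

end Transport

/-! ### Regularity and symmetry of the logarithm and of the powers. -/

section Branch

variable {m : ℕ} {Ω : Set (EuclideanSpace ℂ (Fin m))}
  {K L : EuclideanSpace ℂ (Fin m) → EuclideanSpace ℂ (Fin m) → ℂ} {t : ℝ}

open ContinuousLinearMap

theorem conjVec_conjVec (w : EuclideanSpace ℂ (Fin m)) : conjVec (conjVec w) = w := by
  ext i; simp [conjVec]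

theorem SesquiAnalyticOn.differentiableAt_left (hΩ : IsOpen Ω) (hK : SesquiAnalyticOn K Ω)
    {z w : EuclideanSpace ℂ (Fin m)} (hz : z ∈ Ω) (hw : w ∈ Ω) :
    DifferentiableAt ℂ (fun z => K z w) z := by
  have h1 : DifferentiableOn ℂ (fun z => K z (conjVec (conjVec w))) Ω :=
    hK.comp (f := fun z => (z, conjVec w)) (by fun_prop) fun z hz => by
      simpa [conjVec_conjVec] using ⟨hz, hw⟩
  simp only [conjVec_conjVec] at h1
  exact h1.differentiableAt (hΩ.mem_nhds hz)

theorem IsLogBranchOn.differentiableAt_left (hΩ : IsOpen Ω) (hK : SesquiAnalyticOn K Ω)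
    (hL : IsLogBranchOn L K Ω) {z w : EuclideanSpace ℂ (Fin m)} (hz : z ∈ Ω) (hw : w ∈ Ω) :
    DifferentiableAt ℂ (fun z => L z w) z := by
  refine differentiableAt_of_exp one_ne_zero ?_ ?_
  · have h1 : ContinuousAt (Function.uncurry L) (z, w) :=
      hL.1.continuousAt ((hΩ.prod hΩ).mem_nhds ⟨hz, hw⟩)
    exact h1.comp (f := fun z => (z, w)) (by fun_prop)
  · refine (hK.differentiableAt_left hΩ hz hw).congr_of_eventuallyEq ?_
    filter_upwards [hΩ.mem_nhds hz] with x hx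
    rw [one_mul, hL.2 x hx w hw]

theorem IsLogBranchOn.differentiableAt_kpow_left (hΩ : IsOpen Ω) (hK : SesquiAnalyticOn K Ω)
    (hL : IsLogBranchOn L K Ω) (t : ℝ) {z w : EuclideanSpace ℂ (Fin m)} (hz : z ∈ Ω)
    (hw : w ∈ Ω) : DifferentiableAt ℂ (fun z => kpow L t z w) z :=
  ((hL.differentiableAt_left hΩ hK hz hw).const_mul _).cexp

theorem kpow_ne_zero (t : ℝ) (z w : EuclideanSpace ℂ (Fin m)) : kpow L t z w ≠ 0 :=
  Complex.exp_ne_zero _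

theorem kpow_add (s t : ℝ) (z w : EuclideanSpace ℂ (Fin m)) :
    kpow L (s + t) z w = kpow L s z w * kpow L t z w := by
  simp only [kpow, ← Complex.exp_add]
  push_cast
  ring_nf

theorem conj_kpow (t : ℝ) (z w : EuclideanSpace ℂ (Fin m)) :
    conj (kpow L t z w) = Complex.exp (t * conj (L z w)) := by
  simp [kpow, ← Complex.exp_conj]

theorem conj_kpow_eq_swap (h : (scalarKernel Ω (kpow L t)).PosSemidef)
    {z w : EuclideanSpace ℂ (Fin m)} (hz : z ∈ Ω) (hw : w ∈ Ω) :
    conj (kpow L t z w) = kpow L t w z := by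
  have := congrArg (fun A : ℂ →L[ℂ] ℂ => A 1) (h.isHermitian.apply ⟨w, hw⟩ ⟨z, hz⟩)
  simpa [scalarKernel, star_eq_adjoint, adjoint_id] using this

/-- By Hermitian symmetry, `exp (t * conj (L z v))` is `K^t(v, z)`, holomorphic in `v`; continuity
of `L` removes the exponential. Symmetry is needed only for the power, not for `L`. -/
theorem IsLogBranchOn.differentiableAt_conj_right (hΩ : IsOpen Ω) (hK : SesquiAnalyticOn K Ω)
    (hL : IsLogBranchOn L K Ω) (ht : t ≠ 0) (h : (scalarKernel Ω (kpow L t)).PosSemidef)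
    {z w : EuclideanSpace ℂ (Fin m)} (hz : z ∈ Ω) (hw : w ∈ Ω) :
    DifferentiableAt ℂ (fun v => conj (L z v)) w := by
  refine differentiableAt_of_exp (c := (t : ℂ)) (by exact_mod_cast ht) ?_ ?_
  · have h1 : ContinuousAt (Function.uncurry L) (z, w) :=
      hL.1.continuousAt ((hΩ.prod hΩ).mem_nhds ⟨hz, hw⟩)
    have h2 : ContinuousAt (fun v => L z v) w := h1.comp (f := fun v => (z, v)) (by fun_prop)
    exact Complex.continuous_conj.continuousAt.comp h2
  · refine (hL.differentiableAt_kpow_left hΩ hK t hw hz).congr_of_eventuallyEq ?_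
    filter_upwards [hΩ.mem_nhds hw] with x hx
    rw [← conj_kpow, conj_kpow_eq_swap h hz hx]

theorem pderiv_eq_fderiv {f : EuclideanSpace ℂ (Fin m) → ℂ} {z : EuclideanSpace ℂ (Fin m)}
    (hf : DifferentiableAt ℂ f z) (i : Fin m) :
    pderiv i f z = fderiv ℂ f z (EuclideanSpace.single i 1) :=
  hf.lineDeriv_eq_fderiv

theorem pderiv_congr {f g : EuclideanSpace ℂ (Fin m) → ℂ} {z : EuclideanSpace ℂ (Fin m)}
    (h : f =ᶠ[nhds z] g) (i : Fin m) : pderiv i f z = pderiv i g z :=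
  h.lineDeriv_eq

/-- The second factor vanishes at `z`, so the derivative of `a` drops out of the product rule. -/
theorem pderiv_mul_sub {a l : EuclideanSpace ℂ (Fin m) → ℂ} {z : EuclideanSpace ℂ (Fin m)}
    (ha : DifferentiableAt ℂ a z) (hl : DifferentiableAt ℂ l z) (i : Fin m) :
    pderiv i (fun x => a x * (l x - l z)) z = a z * pderiv i l z := by
  rw [pderiv_eq_fderiv (ha.fun_mul (hl.sub_const _)), pderiv_eq_fderiv hl,
    fderiv_fun_mul ha (hl.sub_const _), fderiv_sub_const]
  simp

theorem IsLogBranchOn.pderivBar_kpow (hΩ : IsOpen Ω) (hK : SesquiAnalyticOn K Ω)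
    (hL : IsLogBranchOn L K Ω) (ht : t ≠ 0) (h : (scalarKernel Ω (kpow L t)).PosSemidef)
    {z w : EuclideanSpace ℂ (Fin m)} (hz : z ∈ Ω) (hw : w ∈ Ω) (i : Fin m) :
    pderivBar i (fun v => kpow L t z v) w =
      t * (kpow L t z w * pderivBar i (fun v => L z v) w) := by
  have hd := hL.differentiableAt_conj_right hΩ hK ht h hz hw
  simp only [pderivBar, conj_kpow]
  rw [pderiv_eq_fderiv (hd.const_mul _).cexp, pderiv_eq_fderiv hd,
    (hd.hasFDerivAt.const_mul (t : ℂ)).cexp.fderiv]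
  simp only [smul_apply, smul_eq_mul, map_mul, Complex.conj_ofReal,
    ← conj_kpow, Complex.conj_conj]
  ring

theorem pderivBar_kpow_eq_conj (hΩ : IsOpen Ω) (h : (scalarKernel Ω (kpow L t)).PosSemidef)
    {z w : EuclideanSpace ℂ (Fin m)} (hz : z ∈ Ω) (hw : w ∈ Ω) (i : Fin m) :
    pderivBar i (fun v => kpow L t z v) w = conj (pderiv i (fun v => kpow L t v z) w) := by
  rw [pderivBar]
  congr 1
  refine pderiv_congr ?_ i
  filter_upwards [hΩ.mem_nhds hw] with x hx using conj_kpow_eq_swap h hz hx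

end Branch

/-! ### Evaluations and derivatives on the diagonal. -/

section Evaluation

variable {m : ℕ} {Ω : Set (EuclideanSpace ℂ (Fin m))}
  {T : Type*} [NormedAddCommGroup T] [InnerProductSpace ℂ T] [RKHS ℂ T (Ω × Ω) ℂ]

open Classical in
/-- The evaluation at a point of `Ω × Ω`, extended by zero. -/
def evExt (T : Type*) [NormedAddCommGroup T] [InnerProductSpace ℂ T] [RKHS ℂ T (Ω × Ω) ℂ]
    (x : EuclideanSpace ℂ (Fin m) × EuclideanSpace ℂ (Fin m)) : T →L[ℂ] ℂ :=
  if h : x.1 ∈ Ω ∧ x.2 ∈ Ω then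
    ContinuousLinearMap.proj (φ := fun _ : Ω × Ω => ℂ) (⟨x.1, h.1⟩, ⟨x.2, h.2⟩) ∘L RKHS.coeCLM ℂ
  else 0

theorem evExt_of_mem {x : EuclideanSpace ℂ (Fin m) × EuclideanSpace ℂ (Fin m)}
    (h₁ : x.1 ∈ Ω) (h₂ : x.2 ∈ Ω) (f : T) : evExt T x f = f (⟨x.1, h₁⟩, ⟨x.2, h₂⟩) := by
  simp [evExt, h₁, h₂]

theorem evExt_of_notMem {x : EuclideanSpace ℂ (Fin m) × EuclideanSpace ℂ (Fin m)}
    (h : ¬(x.1 ∈ Ω ∧ x.2 ∈ Ω)) (f : T) : evExt T x f = 0 := by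
  rw [evExt, dif_neg h, zero_apply]

theorem extend_eq_evExt (f : T) :
    (Function.extend (Prod.map Subtype.val Subtype.val) f 0 :
      EuclideanSpace ℂ (Fin m) × EuclideanSpace ℂ (Fin m) → ℂ) = fun x => evExt T x f := by
  funext x
  have hinj : Function.Injective
      (Prod.map Subtype.val Subtype.val : Ω × Ω → _) :=
    Subtype.val_injective.prodMap Subtype.val_injective
  by_cases h : x.1 ∈ Ω ∧ x.2 ∈ Ω
  · rw [evExt_of_mem h.1 h.2]
    exact hinj.extend_apply f 0 (⟨x.1, h.1⟩, ⟨x.2, h.2⟩)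
  · rw [evExt_of_notMem h, Function.extend_apply']
    · rfl
    · rintro ⟨y, rfl⟩
      exact h ⟨y.1.2, y.2.2⟩

theorem zeroExt_of_mem {E : Type*} {S : Set E} (f : S → ℂ) {x : E} (hx : x ∈ S) :
    zeroExt f x = f ⟨x, hx⟩ :=
  Subtype.val_injective.extend_apply f 0 ⟨x, hx⟩

theorem zeroExt_of_notMem {E : Type*} {S : Set E} (f : S → ℂ) {x : E} (hx : x ∉ S) :
    zeroExt f x = 0 := by
  simp [zeroExt, hx]

theorem zeroExt_fst (f : T) (w : Ω) :
    (zeroExt fun z : Ω => f (z, w)) = fun z => evExt T (z, (w : EuclideanSpace ℂ (Fin m))) f := by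
  funext x
  by_cases h : x ∈ Ω
  · rw [zeroExt_of_mem _ h, evExt_of_mem h w.2]
  · rw [zeroExt_of_notMem _ h, evExt_of_notMem (by simp [h])]

theorem zeroExt_snd (f : T) (w : Ω) :
    (zeroExt fun z : Ω => f (w, z)) = fun z => evExt T ((w : EuclideanSpace ℂ (Fin m)), z) f := by
  funext x
  by_cases h : x ∈ Ω
  · rw [zeroExt_of_mem _ h, evExt_of_mem w.2 h]
  · rw [zeroExt_of_notMem _ h, evExt_of_notMem (by simp [h])]

/-- Every function of the space is holomorphic. -/
def Holomorphic (T : Type*) [NormedAddCommGroup T] [InnerProductSpace ℂ T]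
    [RKHS ℂ T (Ω × Ω) ℂ] : Prop :=
  ∀ f : T, ∀ x ∈ Ω ×ˢ Ω, DifferentiableAt ℂ (fun x => evExt T x f) x

theorem Holomorphic.pderiv_fst (hT : Holomorphic T) (f : T) (w : Ω) (i : Fin m) :
    pderiv i (zeroExt fun z : Ω => f (z, w)) w =
      fderiv ℂ (fun x => evExt T x f) (w, w) (EuclideanSpace.single i 1, 0) := by
  rw [← (hT f (w, w) ⟨w.2, w.2⟩).lineDeriv_eq_fderiv, zeroExt_fst, pderiv]
  simp [lineDeriv]

theorem Holomorphic.hasLineDerivAt_snd (hT : Holomorphic T) (f : T) (w : Ω) (i : Fin m) :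
    HasLineDerivAt ℂ (zeroExt fun z : Ω => f (w, z))
      (fderiv ℂ (fun x => evExt T x f) (w, w) (0, EuclideanSpace.single i 1))
      (w : EuclideanSpace ℂ (Fin m)) (EuclideanSpace.single i 1) := by
  have := (hT f (w, w) ⟨w.2, w.2⟩).hasFDerivAt.hasLineDerivAt (0, EuclideanSpace.single i 1)
  rw [zeroExt_snd]
  simpa [HasLineDerivAt] using this

theorem Holomorphic.pderiv_snd (hT : Holomorphic T) (f : T) (w : Ω) (i : Fin m) :
    pderiv i (zeroExt fun z : Ω => f (w, z)) w =
      fderiv ℂ (fun x => evExt T x f) (w, w) (0, EuclideanSpace.single i 1) :=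
  (hT.hasLineDerivAt_snd f w i).lineDeriv

/-- The definition of `A₁` demands that the derivatives exist and vanish; holomorphy makes existence
automatic. -/
theorem Holomorphic.mem_A₁_iff (hT : Holomorphic T) (f : T) :
    f ∈ A₁ T ↔ f ∈ A₀ T ∧ ∀ (w : Ω) (i : Fin m),
      fderiv ℂ (fun x => evExt T x f) (w, w) (0, EuclideanSpace.single i 1) = 0 := by
  constructor
  · intro h
    refine ⟨fun w => (h w).1, fun w i => ?_⟩
    rw [← hT.pderiv_snd]
    exact ((h w).2 i).lineDeriv
  · rintro ⟨h0, h1⟩ w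
    refine ⟨h0 w, fun i => ?_⟩
    rw [← h1 w i]
    exact hT.hasLineDerivAt_snd f w i

/-- The sum of the two partial derivatives of a function that vanishes on the diagonal. -/
theorem Holomorphic.fderiv_add_fderiv_eq_zero (hT : Holomorphic T) {f : T} (hf : f ∈ A₀ T)
    (w : Ω) (v : EuclideanSpace ℂ (Fin m)) :
    fderiv ℂ (fun x => evExt T x f) (w, w) (v, 0) +
      fderiv ℂ (fun x => evExt T x f) (w, w) (0, v) = 0 := by
  rw [← map_add, ← (hT f (w, w) ⟨w.2, w.2⟩).lineDeriv_eq_fderiv, lineDeriv]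
  -- The line in direction `(v, v)` stays on the diagonal, where `f` vanishes; outside `Ω × Ω` the
  -- extension by zero does.
  have h : (fun t : ℂ => evExt T (((w : EuclideanSpace ℂ (Fin m)),
      (w : EuclideanSpace ℂ (Fin m))) + t • ((v, 0) + (0, v))) f) = fun _ => 0 := by
    funext t
    by_cases h : (w : EuclideanSpace ℂ (Fin m)) + t • v ∈ Ω
    · rw [evExt_of_mem (by simpa using h) (by simpa using h)]
      simpa using hf ⟨_, h⟩
    · rw [evExt_of_notMem (by simpa using h)]
  rw [h, deriv_const]

end Evaluation

/-! ### The kernel of the tensor product and holomorphy of its elements. -/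

section TensorKernel

variable {m : ℕ} {Ω : Set (EuclideanSpace ℂ (Fin m))}
  {K L : EuclideanSpace ℂ (Fin m) → EuclideanSpace ℂ (Fin m) → ℂ} {α β : ℝ}
  [hKα : Fact (scalarKernel Ω (kpow L α)).PosSemidef]
  [hKβ : Fact (scalarKernel Ω (kpow L β)).PosSemidef]

open Filter Topology

/-- The reproducing kernel of the tensor product. -/
theorem kerFun_tensorSpace_apply (p q : Ω × Ω) :
    RKHS.kerFun (TensorSpace Ω L α β) p 1 q = kpow L α q.1 p.1 * kpow L β q.2 p.2 := by
  have h : RKHS.kerFun (TensorSpace Ω L α β) p 1 =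
      kerTensor (RKHS.OfKernel (scalarKernel Ω (kpow L α)))
        (RKHS.OfKernel (scalarKernel Ω (kpow L β))) p := by
    refine ext_inner_right ℂ fun f => ?_
    rw [RKHS.kerFun_inner]
    have h1 : ⟪(1 : ℂ), f p⟫_ℂ = f p := by simp
    exact h1
  rw [h, kerTensor, tmul_apply, RKHS.kerFun_apply, RKHS.kerFun_apply,
    RKHS.OfKernel.kernel_ofKernel, RKHS.OfKernel.kernel_ofKernel]
  simp [scalarKernel]

/-- Cauchy–Schwarz against the kernel function at `p`, whose squared norm is the kernel at `(p, p)`.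
-/
theorem norm_apply_sq_le (f : TensorSpace Ω L α β) (p : Ω × Ω) :
    ‖f p‖ ^ 2 ≤ ‖kpow L α p.1 p.1 * kpow L β p.2 p.2‖ * ‖f‖ ^ 2 := by
  have h1 := norm_inner_le_norm (𝕜 := ℂ) (RKHS.kerFun (TensorSpace Ω L α β) p 1) f
  have h2 : ‖RKHS.kerFun (TensorSpace Ω L α β) p 1‖ ^ 2 =
      ‖kpow L α p.1 p.1 * kpow L β p.2 p.2‖ := by
    rw [← kerFun_tensorSpace_apply, ← inner_self_eq_norm_sq (𝕜 := ℂ), inner_self_re_eq_norm,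
      RKHS.kerFun_inner]
    simp
  rw [RKHS.kerFun_inner] at h1
  rw [← h2, ← mul_pow]
  have h3 : ⟪(1 : ℂ), f p⟫_ℂ = f p := by simp
  rw [h3] at h1
  gcongr

/-- The functions of the tensor product are holomorphic. -/
theorem holomorphic_tensorSpace (hΩ : IsOpen Ω) (hK : SesquiAnalyticOn K Ω)
    (hL : IsLogBranchOn L K Ω) : Holomorphic (TensorSpace Ω L α β) := by
  have hU : IsOpen (Ω ×ˢ Ω) := hΩ.prod hΩ
  suffices h : ∀ f : TensorSpace Ω L α β, DifferentiableOn ℂ (fun x => evExt _ x f) (Ω ×ˢ Ω) from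
    fun f x hx => (h f).differentiableAt (hU.mem_nhds hx)
  intro f
  refine differentiableOn_of_mem_closure hU (evExt (TensorSpace Ω L α β)) (fun p hp => ?_) ?_
  · let k : EuclideanSpace ℂ (Fin m) × EuclideanSpace ℂ (Fin m) → ℝ := fun x =>
      ‖kpow L α x.1 x.1 * kpow L β x.2 x.2‖
    have hdiag : ∀ (t : ℝ), ∀ z ∈ Ω, ContinuousAt (fun z => kpow L t z z) z := by
      intro t z hz
      have h1 : ContinuousAt (fun z => L z z) z :=
        (hL.1.continuousAt (x := (z, z)) (hU.mem_nhds ⟨hz, hz⟩)).comp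
          (f := fun z => (z, z)) (by fun_prop)
      exact (continuousAt_const.mul h1).cexp
    have hk : ContinuousAt k p := by
      have h1 : ContinuousAt (fun x : EuclideanSpace ℂ (Fin m) × EuclideanSpace ℂ (Fin m) =>
          kpow L α x.1 x.1) p := (hdiag α p.1 hp.1).comp continuousAt_fst
      have h2 : ContinuousAt (fun x : EuclideanSpace ℂ (Fin m) × EuclideanSpace ℂ (Fin m) =>
          kpow L β x.2 x.2) p := (hdiag β p.2 hp.2).comp continuousAt_snd
      exact (h1.mul h2).norm
    -- The diagonal of the kernel is continuous, hence below `k p + 1` near `p`.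
    refine ⟨√(k p + 1), ?_⟩
    filter_upwards [hU.mem_nhds hp, hk.eventually (gt_mem_nhds (lt_add_one (k p)))] with x hx hkx
    refine ContinuousLinearMap.opNorm_le_bound _ (Real.sqrt_nonneg _) fun g => ?_
    rw [evExt_of_mem hx.1 hx.2]
    refine le_of_sq_le_sq ((norm_apply_sq_le g _).trans ?_) (by positivity)
    rw [mul_pow, Real.sq_sqrt (by positivity)]
    gcongr
  · have hf : f ∈ (Submodule.span ℂ {RKHS.kerFun (TensorSpace Ω L α β) x v |
        (x) (v)}).topologicalClosure := by
      rw [RKHS.kerFun_dense]; trivial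
    refine closure_mono ?_ hf
    intro g hg
    induction hg using Submodule.span_induction with
    | mem g hg =>
      obtain ⟨p, v, rfl⟩ := hg
      have h1 : DifferentiableOn ℂ (fun x : EuclideanSpace ℂ (Fin m) × EuclideanSpace ℂ (Fin m) =>
          v * (kpow L α x.1 p.1 * kpow L β x.2 p.2)) (Ω ×ˢ Ω) := by
        intro x hx
        have ha : DifferentiableAt ℂ (fun x : EuclideanSpace ℂ (Fin m) ×
            EuclideanSpace ℂ (Fin m) => kpow L α x.1 p.1) x :=
          (hL.differentiableAt_kpow_left hΩ hK α hx.1 p.1.2).comp x differentiableAt_fst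
        have hb : DifferentiableAt ℂ (fun x : EuclideanSpace ℂ (Fin m) ×
            EuclideanSpace ℂ (Fin m) => kpow L β x.2 p.2) x :=
          (hL.differentiableAt_kpow_left hΩ hK β hx.2 p.2.2).comp x differentiableAt_snd
        exact ((ha.mul hb).const_mul v).differentiableWithinAt
      refine h1.congr fun x hx => ?_
      rw [evExt_of_mem hx.1 hx.2]
      have h2 : RKHS.kerFun (TensorSpace Ω L α β) p v =
          v • RKHS.kerFun (TensorSpace Ω L α β) p 1 := by
        rw [← map_smul, smul_eq_mul, mul_one]
      rw [h2, RKHS.coe_smul, Pi.smul_apply, kerFun_tensorSpace_apply, smul_eq_mul]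
    | zero => simp
    | add g₁ g₂ _ _ h₁ h₂ =>
      simp only [Set.mem_ofPred_eq, map_add] at h₁ h₂ ⊢
      exact h₁.add h₂
    | smul c g _ h =>
      simp only [Set.mem_ofPred_eq, map_smul] at h ⊢
      exact h.const_smul c

end TensorKernel

/-! ### Riesz vectors of the derivatives and their closed span. -/

section Derivatives

variable {m : ℕ} {Ω : Set (EuclideanSpace ℂ (Fin m))}
  {T : Type*} [NormedAddCommGroup T] [InnerProductSpace ℂ T] [CompleteSpace T]
  [RKHS ℂ T (Ω × Ω) ℂ]

/-- The vector that represents the derivative in the direction `v` at the point `(w, w)`. -/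
def derivVec (hT : Holomorphic T) (w : Ω)
    (v : EuclideanSpace ℂ (Fin m) × EuclideanSpace ℂ (Fin m)) : T :=
  (InnerProductSpace.toDual ℂ T).symm
    (exists_clm_eq_fderiv (evExt T) (fun f => hT f (w, w) ⟨w.2, w.2⟩) v).choose

theorem derivVec_inner (hT : Holomorphic T) (w : Ω)
    (v : EuclideanSpace ℂ (Fin m) × EuclideanSpace ℂ (Fin m)) (f : T) :
    ⟪derivVec hT w v, f⟫_ℂ = fderiv ℂ (fun x => evExt T x f) (w, w) v := by
  rw [derivVec, InnerProductSpace.toDual_symm_apply]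
  exact (exists_clm_eq_fderiv (evExt T) (fun f => hT f (w, w) ⟨w.2, w.2⟩) v).choose_spec f

theorem derivVec_apply (hT : Holomorphic T) (w : Ω)
    (v : EuclideanSpace ℂ (Fin m) × EuclideanSpace ℂ (Fin m)) (q : Ω × Ω) :
    derivVec hT w v q =
      conj (fderiv ℂ (fun x => evExt T x (RKHS.kerFun T q 1)) (w, w) v) := by
  rw [← derivVec_inner hT, inner_conj_symm, RKHS.kerFun_inner]
  simp

/-- The vector that represents `f ↦ (β ∂_i f - α ∂_{m+i} f) (w, w)`. -/
def phiVec (hT : Holomorphic T) (α β : ℝ) (i : Fin m) (w : Ω) : T :=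
  (β : ℂ) • derivVec hT w (EuclideanSpace.single i 1, 0) -
    (α : ℂ) • derivVec hT w (0, EuclideanSpace.single i 1)

theorem phiVec_inner (hT : Holomorphic T) (α β : ℝ) (i : Fin m) (w : Ω) (f : T) :
    ⟪phiVec hT α β i w, f⟫_ℂ =
      β * fderiv ℂ (fun x => evExt T x f) (w, w) (EuclideanSpace.single i 1, 0) -
        α * fderiv ℂ (fun x => evExt T x f) (w, w) (0, EuclideanSpace.single i 1) := by
  simp [phiVec, derivVec_inner]

theorem phiVec_inner_eq_pderiv (hT : Holomorphic T) (α β : ℝ) (i : Fin m) (w : Ω) (f : T) :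
    ⟪phiVec hT α β i w, f⟫_ℂ =
      β * pderiv i (zeroExt fun z : Ω => f (z, w)) w -
        α * pderiv i (zeroExt fun ζ : Ω => f (w, ζ)) w := by
  rw [phiVec_inner, hT.pderiv_fst, hT.pderiv_snd]

theorem R₁_apply (hT : Holomorphic T) (α β : ℝ) (i : Fin m) (w : Ω) (f : T) :
    R₁ α β ⇑f w i =
      ((1 / Real.sqrt (α * β * (α + β)) : ℝ) : ℂ) * ⟪phiVec hT α β i w, f⟫_ℂ := by
  rw [phiVec_inner_eq_pderiv]
  rfl

/-- Among the functions that vanish on the diagonal, those in `A₁` are the ones orthogonal to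
the vectors `φ_i(w)`. -/
theorem mem_A₁_iff_forall_inner (hT : Holomorphic T) {α β : ℝ} (hαβ : α + β ≠ 0) {f : T}
    (hf : f ∈ A₀ T) : f ∈ A₁ T ↔ ∀ i w, ⟪phiVec hT α β i w, f⟫_ℂ = 0 := by
  have key : ∀ (i : Fin m) (w : Ω), ⟪phiVec hT α β i w, f⟫_ℂ =
      -(((α + β : ℝ) : ℂ) *
        fderiv ℂ (fun x => evExt T x f) (w, w) (0, EuclideanSpace.single i 1)) := by
    intro i w
    rw [phiVec_inner, eq_neg_of_add_eq_zero_left (hT.fderiv_add_fderiv_eq_zero hf w _)]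
    push_cast
    ring
  have hne : ((α + β : ℝ) : ℂ) ≠ 0 := by exact_mod_cast hαβ
  simp only [hT.mem_A₁_iff, hf, true_and, key, neg_eq_zero, mul_eq_zero, hne, false_or]
  exact forall_comm

/-- If all `φ_i(w)` vanish on the diagonal, then their closed span is `A₀ ⊖ A₁`. -/
theorem topologicalClosure_span_phiVec (hT : Holomorphic T) {α β : ℝ} (hαβ : α + β ≠ 0)
    (h0 : ∀ i w, phiVec hT α β i w ∈ A₀ T) :
    (Submodule.span ℂ {f | ∃ i w, f = phiVec hT α β i w}).topologicalClosure = S₁ T := by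
  set M := (Submodule.span ℂ {f | ∃ i w, f = phiVec hT α β i w}).topologicalClosure with hM
  have hphi : ∀ i w, phiVec hT α β i w ∈ M := fun i w =>
    Submodule.le_topologicalClosure _ (Submodule.subset_span ⟨i, w, rfl⟩)
  have hle : M ≤ S₁ T := by
    refine Submodule.topologicalClosure_minimal _ (Submodule.span_le.mpr ?_) (isClosed_S₁ T)
    rintro _ ⟨i, w, rfl⟩
    refine ⟨h0 i w, (Submodule.mem_orthogonal' _ _).mpr fun f hf => ?_⟩
    exact (mem_A₁_iff_forall_inner hT hαβ ((hT.mem_A₁_iff f).mp hf).1).mp hf i w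
  refine le_antisymm hle fun f hf => ?_
  have : CompleteSpace M := (Submodule.isClosed_topologicalClosure _).completeSpace_coe
  have hn : M.starProjection f ∈ M := Submodule.starProjection_apply_mem _ _
  -- The part of `f` orthogonal to all `φ_i(w)` remains in `A₀ ⊖ A₁` and lies in `A₁` by the pairing
  -- criterion; being orthogonal to itself, it is zero.
  have hd : f - M.starProjection f ∈ S₁ T := (S₁ T).sub_mem hf (hle hn)
  have hd1 : f - M.starProjection f ∈ A₁ T :=
    (mem_A₁_iff_forall_inner hT hαβ hd.1).mpr fun i w =>
      (Submodule.mem_orthogonal _ _).mp (Submodule.sub_starProjection_mem_orthogonal f) _ (hphi i w)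
  have h := (Submodule.mem_orthogonal _ _).mp hd.2 _ hd1
  rw [sub_eq_zero.mp (inner_self_eq_zero.mp h)]
  exact hn

/-- The feature map of the kernel `𝕂`. -/
def feature (hT : Holomorphic T) (α β : ℝ) (w : Ω) : EuclideanSpace ℂ (Fin m) →L[ℂ] T :=
  ((1 / Real.sqrt (α * β * (α + β)) : ℝ) : ℂ) •
    ∑ i, (EuclideanSpace.proj i).smulRight (phiVec hT α β i w)

theorem feature_apply (hT : Holomorphic T) (α β : ℝ) (w : Ω) (η : EuclideanSpace ℂ (Fin m)) :
    feature hT α β w η = ((1 / Real.sqrt (α * β * (α + β)) : ℝ) : ℂ) •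
      ∑ i, η i • phiVec hT α β i w := by
  simp [feature]

/-- Pairing with basis vectors reads off the components. This identifies `R₁` with the analysis map
of the feature map. -/
theorem adjoint_feature_apply (hT : Holomorphic T) (α β : ℝ) (w : Ω) (f : T) :
    (feature hT α β w).adjoint f = R₁ α β ⇑f w := by
  ext i
  have h := ContinuousLinearMap.adjoint_inner_right (feature hT α β w)
    (EuclideanSpace.single i 1) f
  rw [EuclideanSpace.inner_single_left, map_one, one_mul] at h
  rw [h, R₁_apply hT, feature_apply]
  simp only [inner_smul_left, Complex.conj_ofReal]
  congr 2
  simp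

end Derivatives

/-! ### Explicit form of the Riesz vectors and their Gram matrix. -/

section Computation

variable {m : ℕ} {Ω : Set (EuclideanSpace ℂ (Fin m))}
  {K L : EuclideanSpace ℂ (Fin m) → EuclideanSpace ℂ (Fin m) → ℂ} {α β : ℝ}
  [hKα : Fact (scalarKernel Ω (kpow L α)).PosSemidef]
  [hKβ : Fact (scalarKernel Ω (kpow L β)).PosSemidef]

theorem derivVec_fst_apply (hΩ : IsOpen Ω) (hK : SesquiAnalyticOn K Ω)
    (hL : IsLogBranchOn L K Ω) (hT : Holomorphic (TensorSpace Ω L α β)) (i : Fin m)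
    (w : Ω) (q : Ω × Ω) :
    derivVec hT w (EuclideanSpace.single i 1, 0) q =
      pderivBar i (fun v => kpow L α q.1 v) w * kpow L β q.2 w := by
  have hd := hL.differentiableAt_kpow_left hΩ hK α w.2 q.1.2
  rw [derivVec_apply, ← hT.pderiv_fst, pderivBar_kpow_eq_conj hΩ hKα.out q.1.2 w.2,
    ← conj_kpow_eq_swap hKβ.out w.2 q.2.2, ← map_mul]
  congr 1
  rw [pderiv_congr (g := fun z => kpow L α z q.1 * kpow L β w q.2)]
  · rw [pderiv_eq_fderiv (hd.mul_const _), pderiv_eq_fderiv hd, fderiv_mul_const hd]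
    simp [mul_comm]
  · filter_upwards [hΩ.mem_nhds w.2] with x hx
    rw [zeroExt_of_mem _ hx, kerFun_tensorSpace_apply]

theorem derivVec_snd_apply (hΩ : IsOpen Ω) (hK : SesquiAnalyticOn K Ω)
    (hL : IsLogBranchOn L K Ω) (hT : Holomorphic (TensorSpace Ω L α β)) (i : Fin m)
    (w : Ω) (q : Ω × Ω) :
    derivVec hT w (0, EuclideanSpace.single i 1) q =
      kpow L α q.1 w * pderivBar i (fun v => kpow L β q.2 v) w := by
  have hd := hL.differentiableAt_kpow_left hΩ hK β w.2 q.2.2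
  rw [derivVec_apply, ← hT.pderiv_snd, pderivBar_kpow_eq_conj hΩ hKβ.out q.2.2 w.2,
    ← conj_kpow_eq_swap hKα.out w.2 q.1.2, ← map_mul]
  congr 1
  rw [pderiv_congr (g := fun z => kpow L α w q.1 * kpow L β z q.2)]
  · rw [pderiv_eq_fderiv (hd.const_mul _), pderiv_eq_fderiv hd, fderiv_const_mul hd]
    simp
  · filter_upwards [hΩ.mem_nhds w.2] with x hx
    rw [zeroExt_of_mem _ hx, kerFun_tensorSpace_apply]

theorem coe_phiVec (hΩ : IsOpen Ω) (hK : SesquiAnalyticOn K Ω)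
    (hL : IsLogBranchOn L K Ω) (hT : Holomorphic (TensorSpace Ω L α β)) (i : Fin m) (w : Ω) :
    ⇑(phiVec hT α β i w) = phi Ω L α β i w := by
  funext q
  rw [phiVec, RKHS.coe_sub, RKHS.coe_smul, RKHS.coe_smul, Pi.sub_apply, Pi.smul_apply,
    Pi.smul_apply, derivVec_fst_apply hΩ hK hL, derivVec_snd_apply hΩ hK hL]
  rfl

theorem phi_apply (hΩ : IsOpen Ω) (hK : SesquiAnalyticOn K Ω) (hL : IsLogBranchOn L K Ω)
    (hα : α ≠ 0) (hβ : β ≠ 0) (i : Fin m) (w : Ω) (q : Ω × Ω) :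
    phi Ω L α β i w q = α * β * kpow L α q.1 w * kpow L β q.2 w *
      (pderivBar i (fun v => L q.1 v) w - pderivBar i (fun v => L q.2 v) w) := by
  rw [phi, hL.pderivBar_kpow hΩ hK hα hKα.out q.1.2 w.2,
    hL.pderivBar_kpow hΩ hK hβ hKβ.out q.2.2 w.2]
  ring

/-- On the slice `(x, w)`, the function is `∂bar_j K^α(x, w) / (α K^α(x, w))`. Up to the constant
factor `K^β(w, w)`, the numerator is the slice of an element of `𝒯`, hence holomorphic in `x`. -/
theorem differentiableAt_pderivBar (hΩ : IsOpen Ω) (hK : SesquiAnalyticOn K Ω)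
    (hL : IsLogBranchOn L K Ω) (hα : α ≠ 0) (hT : Holomorphic (TensorSpace Ω L α β)) (j : Fin m)
    (z w : Ω) :
    DifferentiableAt ℂ (fun x => pderivBar j (fun v => L x v) w)
      (z : EuclideanSpace ℂ (Fin m)) := by
  have h1 : DifferentiableAt ℂ (fun x => evExt _ (x, (w : EuclideanSpace ℂ (Fin m)))
      (derivVec hT w (EuclideanSpace.single j 1, 0))) (z : EuclideanSpace ℂ (Fin m)) :=
    (hT _ (z, w) ⟨z.2, w.2⟩).comp (z : EuclideanSpace ℂ (Fin m))
      (f := fun x => (x, (w : EuclideanSpace ℂ (Fin m)))) (by fun_prop)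
  have h2 := hL.differentiableAt_kpow_left hΩ hK α z.2 w.2
  have h3 := (h1.mul_const (kpow L β w w)⁻¹).fun_mul
    ((h2.const_mul (α : ℂ)).inv (mul_ne_zero (by exact_mod_cast hα) (kpow_ne_zero _ _ _)))
  refine h3.congr_of_eventuallyEq ?_
  filter_upwards [hΩ.mem_nhds z.2] with x hx
  rw [evExt_of_mem hx w.2, derivVec_fst_apply hΩ hK hL,
    hL.pderivBar_kpow hΩ hK hα hKα.out hx w.2, Pi.inv_apply]
  have ha := kpow_ne_zero (L := L) α x w
  have hb := kpow_ne_zero (L := L) β w w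
  have hα' : (α : ℂ) ≠ 0 := by exact_mod_cast hα
  field_simp

/-- By `phi_apply`, `φ_j(w)` near `(z, z)` is a prefactor times a difference vanishing on the
diagonal, so only that difference is differentiated. The two slots contribute with opposite signs,
and the weights `β` and `-α` add up to `α + β`. -/
theorem phiVec_inner_phiVec (hΩ : IsOpen Ω) (hK : SesquiAnalyticOn K Ω)
    (hL : IsLogBranchOn L K Ω) (hα : α ≠ 0) (hβ : β ≠ 0)
    (hT : Holomorphic (TensorSpace Ω L α β)) (i j : Fin m) (z w : Ω) :
    ⟪phiVec hT α β i z, phiVec hT α β j w⟫_ℂ =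
      α * β * (α + β) * (kpow L (α + β) z w *
        pderiv i (fun x => pderivBar j (fun v => L x v) w) z) := by
  have hl := differentiableAt_pderivBar hΩ hK hL hα hT j z w
  have ha := ((hL.differentiableAt_kpow_left hΩ hK α z.2 w.2).const_mul
    ((α : ℂ) * β)).mul_const (kpow L β z w)
  have hb := (hL.differentiableAt_kpow_left hΩ hK β z.2 w.2).const_mul
    (-((α : ℂ) * β * kpow L α z w))
  have h1 : (zeroExt fun x : Ω => phi Ω L α β j w (x, z)) =ᶠ[nhds (z : EuclideanSpace ℂ (Fin m))]
      fun x => α * β * kpow L α x w * kpow L β z w *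
        (pderivBar j (fun v => L x v) w - pderivBar j (fun v => L z v) w) := by
    filter_upwards [hΩ.mem_nhds z.2] with x hx
    rw [zeroExt_of_mem _ hx, phi_apply hΩ hK hL hα hβ]
  have h2 : (zeroExt fun x : Ω => phi Ω L α β j w (z, x)) =ᶠ[nhds (z : EuclideanSpace ℂ (Fin m))]
      fun x => -(α * β * kpow L α z w) * kpow L β x w *
        (pderivBar j (fun v => L x v) w - pderivBar j (fun v => L z v) w) := by
    filter_upwards [hΩ.mem_nhds z.2] with x hx
    rw [zeroExt_of_mem _ hx, phi_apply hΩ hK hL hα hβ]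
    ring
  rw [phiVec_inner_eq_pderiv, coe_phiVec hΩ hK hL, pderiv_congr h1, pderiv_congr h2,
    pderiv_mul_sub ha hl, pderiv_mul_sub hb hl, kpow_add]
  ring

theorem bigKernel_eq (hΩ : IsOpen Ω) (hK : SesquiAnalyticOn K Ω)
    (hL : IsLogBranchOn L K Ω) (hα : 0 < α) (hβ : 0 < β)
    (hT : Holomorphic (TensorSpace Ω L α β)) :
    bigKernel Ω L α β =
      Matrix.of fun z w => (feature hT α β z).adjoint ∘L feature hT α β w := by
  ext z w η i
  have hpos : 0 < α * β * (α + β) := by positivity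
  -- The normalization enters once through the feature map and once through its adjoint; its square
  -- cancels the Gram factor.
  have hc : ((1 / Real.sqrt (α * β * (α + β)) : ℝ) : ℂ) *
      ((1 / Real.sqrt (α * β * (α + β)) : ℝ) : ℂ) * (α * β * (α + β)) = 1 := by
    rw [← Complex.ofReal_mul, div_mul_div_comm, Real.mul_self_sqrt hpos.le, one_mul]
    exact_mod_cast one_div_mul_cancel hpos.ne'
  rw [Matrix.of_apply, ContinuousLinearMap.comp_apply, adjoint_feature_apply, R₁_apply hT,
    feature_apply, inner_smul_right, inner_sum, bigKernel, Matrix.of_apply,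
    Matrix.ofLp_toEuclideanCLM, Matrix.mulVec, dotProduct, ← mul_assoc, Finset.mul_sum]
  refine Finset.sum_congr rfl fun j _ => ?_
  rw [inner_smul_right, phiVec_inner_phiVec hΩ hK hL hα.ne' hβ.ne', Matrix.of_apply]
  linear_combination (-(kpow L (α + β) z w *
    pderiv i (fun x => pderivBar j (fun v => L x v) w) z * η j)) * hc

end Computation

end Realization

end

/-! ### Assembly of the theorem. -/

theorem theorem3p3 {m : ℕ} (Ω : Set (EuclideanSpace ℂ (Fin m)))
    (hΩ_open : IsOpen Ω) (hΩ_conn : IsConnected Ω) (hΩ_bdd : Bornology.IsBounded Ω)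
    (K L : EuclideanSpace ℂ (Fin m) → EuclideanSpace ℂ (Fin m) → ℂ)
    (hK : Realization.SesquiAnalyticOn K Ω) (hL : Realization.IsLogBranchOn L K Ω)
    (α β : ℝ) (hα : 0 < α) (hβ : 0 < β)
    [hKα : Fact (Realization.scalarKernel Ω (Realization.kpow L α)).PosSemidef]
    [hKβ : Fact (Realization.scalarKernel Ω (Realization.kpow L β)).PosSemidef] :
    -- the tensor product consists of holomorphic functions and contains the vectors `φ_i(w)`
    (∀ f : Realization.TensorSpace Ω L α β, Realization.HolomorphicOnProd ⇑f) ∧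
    (∀ (i : Fin m) (w : Ω), ∃ f : Realization.TensorSpace Ω L α β,
      ⇑f = Realization.phi Ω L α β i w) ∧
    -- their closed linear span is `A₀ ⊖ A₁`
    Realization.N (Realization.TensorSpace Ω L α β) L α β =
      Realization.S₁ (Realization.TensorSpace Ω L α β) ∧
    -- the Hilbert space of the matrix kernel is the range of `R₁`, with the transported
    -- inner product
    ∃ hpos : (Realization.bigKernel Ω L α β).PosSemidef,
      haveI : Fact (Realization.bigKernel Ω L α β).PosSemidef := ⟨hpos⟩
      Set.range (fun F : RKHS.OfKernel (Realization.bigKernel Ω L α β) => ⇑F) =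
        Set.range (fun f : Realization.TensorSpace Ω L α β => Realization.R₁ α β ⇑f) ∧
      ∀ (f g : Realization.TensorSpace Ω L α β)
        (F G : RKHS.OfKernel (Realization.bigKernel Ω L α β)),
        ⇑F = Realization.R₁ α β ⇑f → ⇑G = Realization.R₁ α β ⇑g →
        ⟪F, G⟫_ℂ = ⟪(Realization.S₁ (Realization.TensorSpace Ω L α β)).starProjection f,
          (Realization.S₁ (Realization.TensorSpace Ω L α β)).starProjection g⟫_ℂ := by
  open Realization in
  have hT : Holomorphic (TensorSpace Ω L α β) := holomorphic_tensorSpace hΩ_open hK hL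
  have hαβ : α + β ≠ 0 := by positivity
  have hphi := coe_phiVec hΩ_open hK hL hT
  have h0 : ∀ i w, phiVec hT α β i w ∈ A₀ (TensorSpace Ω L α β) := by
    intro i w z
    rw [hphi, phi_apply hΩ_open hK hL hα.ne' hβ.ne', sub_self, mul_zero]
  have hspan := topologicalClosure_span_phiVec hT hαβ h0
  have hkernel := bigKernel_eq hΩ_open hK hL hα hβ hT
  have hpos : (bigKernel Ω L α β).PosSemidef := hkernel ▸ posSemidef_adjoint_comp _
  have hmem : ∀ w η, feature hT α β w η ∈ S₁ (TensorSpace Ω L α β) := by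
    intro w η
    rw [feature_apply, ← hspan]
    exact Submodule.smul_mem _ _ (Submodule.sum_mem _ fun i _ => Submodule.smul_mem _ _
      (Submodule.le_topologicalClosure _ (Submodule.subset_span ⟨i, w, rfl⟩)))
  -- An element of `A₀ ⊖ A₁` killed by `R₁` pairs to zero with every `φ_i(w)`, so it belongs to `A₁`
  -- as well and is orthogonal to itself.
  have hzero : ∀ f ∈ S₁ (TensorSpace Ω L α β),
      (∀ w, (feature hT α β w).adjoint f = 0) → f = 0 := by
    intro f hf h
    have hc : ((1 / Real.sqrt (α * β * (α + β)) : ℝ) : ℂ) ≠ 0 := by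
      have : 0 < 1 / Real.sqrt (α * β * (α + β)) := by positivity
      exact_mod_cast this.ne'
    have h1 : f ∈ A₁ (TensorSpace Ω L α β) := by
      refine (mem_A₁_iff_forall_inner hT hαβ hf.1).mpr fun i w => ?_
      have h2 := congrArg (fun v : EuclideanSpace ℂ (Fin m) => v i) (h w)
      simp only [adjoint_feature_apply, R₁_apply hT] at h2
      exact (mul_eq_zero.mp h2).resolve_left hc
    exact inner_self_eq_zero.mp ((Submodule.mem_orthogonal _ _).mp hf.2 _ h1)
  refine ⟨fun f => ?_, fun i w => ⟨_, hphi i w⟩, ?_, hpos, ?_⟩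
  · rw [HolomorphicOnProd, extend_eq_evExt]
    exact fun x hx => (hT f x hx).differentiableWithinAt
  · rw [← hspan, N]
    congr 3
    ext f
    simp only [← hphi, DFunLike.coe_fn_eq]
  · have : Fact (bigKernel Ω L α β).PosSemidef := ⟨hpos⟩
    have h := range_and_inner_of_kernel_eq (H := RKHS.OfKernel (bigKernel Ω L α β))
      (feature hT α β) (fun z w => by rw [RKHS.OfKernel.kernel_ofKernel, hkernel, Matrix.of_apply])
      (S₁ (TensorSpace Ω L α β)) (isClosed_S₁ _) hmem hzero
    simp only [adjoint_feature_apply] at h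
    exact h
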